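/- For every integer $k \ge 1$ there exist constants $C = C(k) > 0$ and $c = c(k) > 0$, depending only on $k$, such that the following holds. Let $N \ge 1$ be an integer, let $K$ be a finite (possibly empty) subset of $\mathbb{T} = \mathbb{R}/\mathbb{Z}$, and let $0 < \eta \le 1$. Writing $\|\cdot\|$ for the distance to the nearest integer, define the Bohr set $$B(K,\eta) := \{x \in \mathbb{Z} : -N/2 \le x < N/2,\ \|\alpha x\| \le \eta \text{ for all } \alpha \in K\}.$$ Then $B(K,\eta)$ contains a $k$th power progression, that is, a set of the form $\{a, a+q^k, a+2q^k, \dots, a+(L-1)q^k\}$ with $a \in \mathbb{Z}$ and integers $q, L \ge 1$, of length $$L \ge c\,\eta\, N^{\exp(-C|K|)}.$$ -/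

import Mathlib

/-- The Bohr set `B(K, η) = {x ∈ [-N/2, N/2) ∩ ℤ : ‖α x‖ ≤ η for all α ∈ K}`, where `K` is a finite
set of frequencies in `𝕋 = ℝ/ℤ`. The norm of `UnitAddCircle` is the distance to the nearest
integer. -/
def bohrSet (N : ℕ) (K : Finset UnitAddCircle) (η : ℝ) : Set ℤ :=
  {x : ℤ | -((N : ℝ) / 2) ≤ (x : ℝ) ∧ (x : ℝ) < (N : ℝ) / 2 ∧ ∀ α ∈ K, ‖x • α‖ ≤ η}

/-- `P` is a finite arithmetic progression `a, a + q ^ k, …, a + (L - 1) q ^ k` of integers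
whose common difference is the `k`th power of a positive integer `q`. Its length is `P.card`. -/
def IsKthPowerProgression (k : ℕ) (P : Finset ℤ) : Prop :=
  ∃ (a : ℤ) (q L : ℕ), 1 ≤ q ∧
    P = (Finset.range L).image (fun i : ℕ => a + (i : ℤ) * (q : ℤ) ^ k)

/-! With d = |K|, it suffices to find 1 ≤ q ≤ M^(B^d) with ‖q^k α‖ ≤ 1/M for every α in K: then 0,
q^k, 2q^k, … stays in the Bohr set for about ηM terms, and M can be taken of order N^(1/(kB+1)^d),
so C = log(kB+1).

Such a q is built one frequency at a time (`exists_pow_nsmul_small_simultaneous`), each frequency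
multiplying the exponent by a constant. A single frequency is Heilbronn's theorem
(`exists_pow_nsmul_small`). If n^k α avoided 0 for all n ≤ Q, `exists_large_sum_stdChar` would give
a large Weyl sum along h n^k α with h ≤ M². Then `weyl_inverse` makes ‖qα‖ at most M^O(1)/Q^k for
some q = M^O(1), so q^k α = q^(k-1)(qα) is small too, a contradiction.

`weyl_inverse` inducts on the degree by differencing; `exists_small_multiple` turns smallness of
‖hβ‖ for many h into a gain of order N for one multiple of β. -/

/-! ### Characters, norms and geometric sums on ℝ/ℤ -/

/-- The standard additive character `x ↦ exp (2πix)` of `ℝ/ℤ`. -/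
noncomputable def stdChar (x : UnitAddCircle) : ℂ := (AddCircle.toCircle x : ℂ)

lemma stdChar_zero : stdChar 0 = 1 := by simp [stdChar]

lemma stdChar_add (x y : UnitAddCircle) : stdChar (x + y) = stdChar x * stdChar y := by
  simp [stdChar, AddCircle.toCircle_add]

lemma stdChar_nsmul (n : ℕ) (x : UnitAddCircle) : stdChar (n • x) = stdChar x ^ n := by
  simp [stdChar, AddCircle.toCircle_nsmul]

lemma norm_stdChar (x : UnitAddCircle) : ‖stdChar x‖ = 1 := Circle.norm_coe _

lemma stdChar_neg (x : UnitAddCircle) :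
    stdChar (-x) = (starRingEnd ℂ) (stdChar x) := by
  rw [stdChar, AddCircle.toCircle_neg]
  exact Circle.coe_inv_eq_conj _

lemma stdChar_sub (x y : UnitAddCircle) :
    stdChar (x - y) = stdChar x * (starRingEnd ℂ) (stdChar y) := by
  rw [sub_eq_add_neg, stdChar_add, stdChar_neg]

lemma norm_sum_stdChar_le {ι : Type*} (s : Finset ι) (f : ι → UnitAddCircle) :
    ‖∑ i ∈ s, stdChar (f i)‖ ≤ s.card := by
  refine (norm_sum_le _ _).trans ?_
  simp [norm_stdChar]

lemma UnitAddCircle.norm_le_half (x : UnitAddCircle) : ‖x‖ ≤ 1 / 2 := by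
  simpa using AddCircle.norm_le_half_period (1 : ℝ) (x := x) one_ne_zero

lemma UnitAddCircle.exists_coe_abs_eq_norm (x : UnitAddCircle) :
    ∃ y : ℝ, (y : UnitAddCircle) = x ∧ |y| = ‖x‖ := by
  induction x using QuotientAddGroup.induction_on with
  | H z =>
    refine ⟨z - round z, ?_, (UnitAddCircle.norm_eq).symm⟩
    have h : ((round z : ℝ) : UnitAddCircle) = 0 := by
      rw [AddCircle.coe_eq_zero_iff]
      exact ⟨round z, by simp⟩
    rw [AddCircle.coe_sub, h, sub_zero]

/-- The multiples of the shortest representative do not wrap around before reaching 1/2. -/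
lemma UnitAddCircle.norm_nsmul_eq (x : UnitAddCircle) (n : ℕ) (h : n * ‖x‖ ≤ 1 / 2) :
    ‖n • x‖ = n * ‖x‖ := by
  obtain ⟨y, rfl, hy⟩ := UnitAddCircle.exists_coe_abs_eq_norm x
  have h1 : |(n : ℝ) * y| = n * ‖(y : UnitAddCircle)‖ := by
    rw [abs_mul, Nat.abs_cast, hy]
  rw [← AddCircle.coe_nsmul, nsmul_eq_mul, ← h1]
  rw [AddCircle.norm_coe_eq_abs_iff _ one_ne_zero, h1]
  simpa using h

lemma UnitAddCircle.norm_nsmul_le (x : UnitAddCircle) (n : ℕ) : ‖n • x‖ ≤ n * ‖x‖ :=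
  _root_.norm_nsmul_le

/-- The chord has length 2|sin πy|, and Jordan's inequality bounds the sine below. -/
lemma four_mul_norm_le_norm_stdChar_sub_one (x : UnitAddCircle) :
    4 * ‖x‖ ≤ ‖stdChar x - 1‖ := by
  obtain ⟨y, rfl, hy⟩ := UnitAddCircle.exists_coe_abs_eq_norm x
  have hle := UnitAddCircle.norm_le_half (y : UnitAddCircle)
  rw [← hy] at hle ⊢
  have h1 : stdChar (y : UnitAddCircle) = Complex.exp (Complex.I * ((2 * Real.pi * y : ℝ) : ℂ)) := by
    rw [stdChar, AddCircle.toCircle_apply_mk, Circle.coe_exp]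
    congr 1
    push_cast
    ring
  rw [h1, Complex.norm_exp_I_mul_ofReal_sub_one, norm_mul, Real.norm_eq_abs, Real.norm_eq_abs]
  have h2 : 2 * Real.pi * y / 2 = Real.pi * y := by ring
  have h3 : |Real.pi * y| = Real.pi * |y| := by rw [abs_mul, abs_of_pos Real.pi_pos]
  have h4 : |Real.pi * y| ≤ Real.pi / 2 := by
    rw [h3]; nlinarith [Real.pi_pos]
  have h5 := Real.mul_abs_le_abs_sin h4
  rw [h3] at h5
  have h6 : 2 / Real.pi * (Real.pi * |y|) = 2 * |y| := by
    field_simp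
  rw [h2, abs_of_pos (by norm_num : (0 : ℝ) < 2)]
  linarith

lemma norm_geom_sum_stdChar (x : UnitAddCircle) (N : ℕ) :
    2 * ‖x‖ * ‖∑ n ∈ Finset.range N, stdChar (n • x)‖ ≤ 1 := by
  have h := four_mul_norm_le_norm_stdChar_sub_one x
  have h1 : (stdChar x - 1) * ∑ n ∈ Finset.range N, stdChar (n • x) = stdChar x ^ N - 1 := by
    simp_rw [stdChar_nsmul]
    exact mul_geom_sum _ _
  have h2 : ‖stdChar x ^ N - 1‖ ≤ 2 := by
    refine (norm_sub_le _ _).trans ?_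
    simp [norm_stdChar]
    norm_num
  rw [← h1, norm_mul] at h2
  nlinarith [norm_nonneg (∑ n ∈ Finset.range N, stdChar (n • x))]

/-! ### Weyl differencing -/

/-- Doubling the triangle counts the diagonal twice, hence the sign condition on it. -/
lemma sum_sum_symm_le {G : ℕ → ℕ → ℝ} (hG : ∀ m n, G m n = G n m) (hd : ∀ n, 0 ≤ G n n)
    (N : ℕ) :
    ∑ m ∈ Finset.range N, ∑ n ∈ Finset.range N, G m n ≤
      2 * ∑ m ∈ Finset.range N, ∑ n ∈ Finset.range (m + 1), G m n := by
  induction N with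
  | zero => simp
  | succ N ih =>
    have h1 : ∑ m ∈ Finset.range N, G m N = ∑ n ∈ Finset.range N, G N n :=
      Finset.sum_congr rfl fun m _ => hG m N
    simp only [Finset.sum_range_succ, Finset.sum_add_distrib] at ih ⊢
    rw [h1]
    linarith [hd N]

lemma sum_sum_triangle {M : Type*} [AddCommMonoid M] (F : ℕ → ℕ → M) (N : ℕ) :
    ∑ m ∈ Finset.range N, ∑ n ∈ Finset.range (m + 1), F m n =
      ∑ h ∈ Finset.range N, ∑ n ∈ Finset.range (N - h), F (n + h) n := by
  have := Finset.sum_range_diag_flip N (fun h n => F (n + h) n)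
  rw [← this]
  refine Finset.sum_congr rfl fun m _ => ?_
  rw [← Finset.sum_flip]
  refine Finset.sum_congr rfl fun h hh => ?_
  congr 1
  have := Finset.mem_range.1 hh
  omega

lemma norm_sq_sum_stdChar_eq (g : ℕ → UnitAddCircle) (N : ℕ) :
    ‖∑ n ∈ Finset.range N, stdChar (g n)‖ ^ 2 =
      ∑ m ∈ Finset.range N, ∑ n ∈ Finset.range N, (stdChar (g m - g n)).re := by
  have h : (∑ n ∈ Finset.range N, stdChar (g n)) *
      (starRingEnd ℂ) (∑ n ∈ Finset.range N, stdChar (g n)) =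
      ∑ m ∈ Finset.range N, ∑ n ∈ Finset.range N, stdChar (g m - g n) := by
    rw [map_sum, Finset.sum_mul_sum]
    simp_rw [stdChar_sub]
  rw [Complex.mul_conj, Complex.normSq_eq_norm_sq] at h
  have h' := congrArg Complex.re h
  rw [Complex.ofReal_re, Complex.re_sum] at h'
  simp_rw [h', Complex.re_sum]

lemma re_stdChar_sub_comm (x y : UnitAddCircle) :
    (stdChar (x - y)).re = (stdChar (y - x)).re := by
  rw [← neg_sub y x, stdChar_neg, Complex.conj_re]

/-- Weyl differencing. -/
lemma norm_sq_sum_stdChar_le (g : ℕ → UnitAddCircle) (N : ℕ) :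
    ‖∑ n ∈ Finset.range N, stdChar (g n)‖ ^ 2 ≤
      2 * ∑ h ∈ Finset.range N, ‖∑ n ∈ Finset.range (N - h), stdChar (g (n + h) - g n)‖ := by
  rw [norm_sq_sum_stdChar_eq]
  refine (sum_sum_symm_le (fun m n => re_stdChar_sub_comm _ _) (fun n => ?_) N).trans ?_
  · simp [stdChar_zero]
  · rw [sum_sum_triangle]
    gcongr with h hh
    rw [← Complex.re_sum]
    exact Complex.re_le_norm _

/-! ### Polynomial phases -/

/-- `g` has degree at most `k` with `k`-th differences given by the multilinear form
`(h₁, …, h_k) ↦ h₁ ⋯ h_k β`. -/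
def HasConstDiff : ℕ → UnitAddCircle → (ℕ → UnitAddCircle) → Prop
  | 0, β, g => ∀ n, g n = β
  | k + 1, β, g => ∀ h : ℕ, HasConstDiff k (h • β) (fun n => g (n + h) - g n)

lemma HasConstDiff.shift {k : ℕ} {β : UnitAddCircle} {g : ℕ → UnitAddCircle}
    (hg : HasConstDiff k β g) (a : ℕ) : HasConstDiff k β (fun n => g (n + a)) := by
  induction k generalizing β g with
  | zero => exact fun n => hg _
  | succ k ih =>
    intro h
    have := ih (hg h)
    simp_rw [add_right_comm _ a h] at this
    exact this

lemma HasConstDiff.zero (k : ℕ) : HasConstDiff k 0 (fun _ => 0) := by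
  induction k with
  | zero => exact fun _ => rfl
  | succ k ih => intro h; simpa using ih

lemma HasConstDiff.add {k : ℕ} {β γ : UnitAddCircle} {f g : ℕ → UnitAddCircle}
    (hf : HasConstDiff k β f) (hg : HasConstDiff k γ g) :
    HasConstDiff k (β + γ) (fun n => f n + g n) := by
  induction k generalizing β γ f g with
  | zero => exact fun n => congrArg₂ (· + ·) (hf n) (hg n)
  | succ k ih =>
    intro h
    have := ih (hf h) (hg h)
    simp only [nsmul_add, add_sub_add_comm]
    exact this

lemma HasConstDiff.sum {ι : Type*} {k : ℕ} (s : Finset ι) {β : ι → UnitAddCircle}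
    {f : ι → ℕ → UnitAddCircle} (hf : ∀ i ∈ s, HasConstDiff k (β i) (f i)) :
    HasConstDiff k (∑ i ∈ s, β i) (fun n => ∑ i ∈ s, f i n) := by
  classical
  induction s using Finset.induction_on with
  | empty => simpa using HasConstDiff.zero k
  | insert a s ha ih =>
    simp only [Finset.sum_insert ha]
    exact (hf a (by simp)).add (ih fun i hi => hf i (by simp [hi]))

/-- Differencing n^j produces all lower monomials, so the induction needs every j ≤ k; in the
binomial expansion only the term of top degree contributes. -/
lemma hasConstDiff_monomial (k j : ℕ) (hj : j ≤ k) (α : UnitAddCircle) :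
    HasConstDiff k (if j = k then k.factorial • α else 0) (fun n => (n ^ j) • α) := by
  induction k generalizing j α with
  | zero =>
    obtain rfl : j = 0 := by omega
    intro n
    simp
  | succ k ih =>
    intro h
    have h1 : (fun n : ℕ => ((n + h) ^ j) • α - (n ^ j) • α) = fun n : ℕ =>
        ∑ i ∈ Finset.range j, (n ^ i) • ((h ^ (j - i) * j.choose i) • α) := by
      funext n
      rw [add_pow, Finset.sum_range_succ, add_nsmul]
      simp only [Nat.sub_self, pow_zero, mul_one, Nat.choose_self, Nat.cast_id]
      rw [add_sub_cancel_right, Finset.sum_smul]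
      refine Finset.sum_congr rfl fun i _ => ?_
      rw [mul_assoc, mul_nsmul']
    rw [h1]
    have h2 := HasConstDiff.sum (k := k) (Finset.range j) (fun i hi =>
      ih i (by have := Finset.mem_range.1 hi; omega) ((h ^ (j - i) * j.choose i) • α))
    convert h2 using 1
    by_cases hjk : j = k + 1
    · subst hjk
      rw [Finset.sum_eq_single k]
      · simp only [if_true, Nat.add_sub_cancel_left, pow_one, Nat.choose_succ_self_right,
          Nat.factorial_succ, ← mul_nsmul']
        congr 1
        ring
      · intro b _ hb; simp [hb]
      · simp
    · rw [if_neg hjk, nsmul_zero, Finset.sum_eq_zero]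
      intro i hi
      rw [if_neg]
      have := Finset.mem_range.1 hi
      omega

lemma hasConstDiff_pow (k : ℕ) (α : UnitAddCircle) :
    HasConstDiff k (k.factorial • α) (fun n => (n ^ k) • α) := by
  simpa using hasConstDiff_monomial k k le_rfl α

/-! ### Inverse Weyl inequality -/

/-- If `‖hβ‖` is small for a positive proportion of `h < N`, then some bounded multiple of `β` is
smaller by a factor of order `N`. -/
lemma exists_small_multiple {N D : ℕ} {A : Finset ℕ} (hA : A ⊆ Finset.range N) (hN : 2 * D < N)
    (hcard : N ≤ D * A.card) {ε : ℝ} (hεD : 32 * ε * D ≤ 1)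
    {β : UnitAddCircle} (hβ : ∀ h ∈ A, ‖h • β‖ ≤ ε) :
    ∃ t : ℕ, 1 ≤ t ∧ t ≤ 2 * D ∧ ‖t • β‖ * N ≤ 16 * ε * D ^ 2 := by
  have hD : 1 ≤ D := by
    rcases Nat.eq_zero_or_pos D with rfl | h
    · omega
    · exact h
  have hDr : (1 : ℝ) ≤ D := by exact_mod_cast hD
  have hAne : A.Nonempty := by
    rw [Finset.nonempty_iff_ne_empty]
    rintro rfl
    simp at hcard
    omega
  have hε : 0 ≤ ε := (norm_nonneg _).trans (hβ _ hAne.choose_spec)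
  have hdiff : ∀ x ∈ A, ∀ y ∈ A, y ≤ x → ‖(x - y) • β‖ ≤ 2 * ε := by
    intro x hx y hy hxy
    rw [sub_nsmul _ hxy, ← sub_eq_add_neg]
    refine (norm_sub_le _ _).trans ?_
    linarith [hβ x hx, hβ y hy]
  -- two elements of `A` are at distance less than `2 * D`
  obtain ⟨t, ht1, htD, htε⟩ : ∃ t : ℕ, 1 ≤ t ∧ t ≤ 2 * D ∧ ‖t • β‖ ≤ 2 * ε := by
    have hlt : (Finset.range (N / (2 * D) + 1)).card < A.card := by
      rw [Finset.card_range]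
      by_contra! hle
      have h1 : N / (2 * D) * (2 * D) ≤ N := Nat.div_mul_le_self _ _
      have h2 : D * A.card ≤ D * (N / (2 * D) + 1) := Nat.mul_le_mul_left _ hle
      nlinarith
    obtain ⟨x, hx, y, hy, hxy, hf⟩ := Finset.exists_ne_map_eq_of_card_lt_of_maps_to hlt
      (f := fun h => h / (2 * D)) (fun h hh => by
        have := Finset.mem_range.1 (hA hh)
        have h2 : h / (2 * D) ≤ N / (2 * D) := Nat.div_le_div_right this.le
        simpa using Nat.lt_succ_of_le h2)
    wlog hle : y ≤ x generalizing x y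
    · exact this y hy x hx hxy.symm hf.symm (by omega)
    refine ⟨x - y, by omega, ?_, hdiff x hx y hy hle⟩
    have h1 := Nat.div_add_mod x (2 * D)
    have h2 := Nat.div_add_mod y (2 * D)
    have h3 := Nat.mod_lt x (by omega : 0 < 2 * D)
    rw [hf] at h1
    omega
  refine ⟨t, ht1, htD, ?_⟩
  set θ := ‖t • β‖ with hθ
  have hNr : (0 : ℝ) < N := by
    have : 0 < N := by omega
    exact_mod_cast this
  rcases (norm_nonneg (t • β)).eq_or_lt with h0 | hpos
  · rw [hθ, ← h0, zero_mul]; positivity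
  rw [← hθ] at hpos
  have hεs : 32 * ε ≤ 1 := by nlinarith
  -- Along step t, ‖w t β‖ = wθ grows linearly for w ≤ W, so it can stay below 2ε only for w ≤ R.
  set W := ⌊1 / (2 * θ)⌋₊ with hW
  have hWle : W * θ ≤ 1 / 2 := by
    have h1 : (W : ℝ) ≤ 1 / (2 * θ) := Nat.floor_le (by positivity)
    calc W * θ ≤ 1 / (2 * θ) * θ := by gcongr
      _ = 1 / 2 := by field_simp
  have hWge : 1 ≤ 4 * θ * W := by
    have h1 : 1 / (2 * θ) < W + 1 := Nat.lt_floor_add_one _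
    rw [div_lt_iff₀ (by positivity)] at h1
    nlinarith
  have hW1 : 0 < W := by
    rcases Nat.eq_zero_or_pos W with h | h
    · rw [h] at hWge; norm_num at hWge
    · exact h
  set R := ⌊2 * ε / θ⌋₊ with hR
  have hRle : R * θ ≤ 2 * ε := by
    have h1 : (R : ℝ) ≤ 2 * ε / θ := Nat.floor_le (by positivity)
    rwa [le_div_iff₀ hpos] at h1
  have htW : 0 < t * W := Nat.mul_pos ht1 hW1
  -- each residue class modulo `t` meets each block of length `t * W` in few points of `A`
  have hcount : A.card ≤
      (R + 1) * (Finset.range t ×ˢ Finset.range (N / (t * W) + 1)).card := by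
    refine Finset.card_le_mul_card_image_of_maps_to (f := fun h => (h % t, h / (t * W)))
      (fun h hh => ?_) _ (fun b _ => ?_)
    · have := Finset.mem_range.1 (hA hh)
      have h2 : h / (t * W) ≤ N / (t * W) := Nat.div_le_div_right this.le
      simp only [Finset.mem_product, Finset.mem_range]
      exact ⟨Nat.mod_lt _ ht1, Nat.lt_succ_of_le h2⟩
    · rcases (A.filter fun h => (h % t, h / (t * W)) = b).eq_empty_or_nonempty with he | hne
      · rw [he]; simp
      set F := A.filter fun h => (h % t, h / (t * W)) = b with hF
      have hm := F.min'_mem hne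
      set m := F.min' hne
      have hsub : F ⊆ (Finset.range (R + 1)).image (fun w => m + t * w) := by
        intro h hh
        have hmh : m ≤ h := F.min'_le h hh
        rw [hF, Finset.mem_filter] at hh hm
        have heq := hh.2.trans hm.2.symm
        rw [Prod.mk.injEq] at heq
        obtain ⟨w, hw⟩ := (Nat.modEq_iff_dvd' hmh).1 heq.1.symm
        have hwW : w < W := by
          have h1 := Nat.div_add_mod h (t * W)
          have h2 := Nat.div_add_mod m (t * W)
          have h3 := Nat.mod_lt h htW
          rw [heq.2] at h1
          have : t * w < t * W := by omega
          exact Nat.lt_of_mul_lt_mul_left this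
        have hsmall : (w : ℝ) * θ ≤ 1 / 2 := by
          refine le_trans ?_ hWle
          gcongr
        have h4 := hdiff h hh.1 m hm.1 hmh
        rw [hw, mul_comm, mul_nsmul', UnitAddCircle.norm_nsmul_eq _ _ hsmall] at h4
        have h5 : w ≤ R := Nat.le_floor ((le_div_iff₀ hpos).2 h4)
        exact Finset.mem_image.2 ⟨w, Finset.mem_range.2 (by omega), by omega⟩
      calc F.card ≤ _ := Finset.card_le_card hsub
        _ ≤ (Finset.range (R + 1)).card := Finset.card_image_le
        _ = R + 1 := Finset.card_range _
  rw [Finset.card_product, Finset.card_range, Finset.card_range] at hcount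
  have hblocks : ((t * (N / (t * W) + 1) : ℕ) : ℝ) ≤ 4 * θ * N + 2 * D := by
    have h1 : t * (N / (t * W)) * W ≤ N := by
      calc t * (N / (t * W)) * W = N / (t * W) * (t * W) := by ring
        _ ≤ N := Nat.div_mul_le_self _ _
    have h1r : ((t * (N / (t * W)) : ℕ) : ℝ) * W ≤ N := by exact_mod_cast h1
    have h2 : (t : ℝ) ≤ 2 * D := by exact_mod_cast htD
    have h3 : ((t * (N / (t * W)) : ℕ) : ℝ) ≤ 4 * θ * N := by
      have hx : (0 : ℝ) ≤ ((t * (N / (t * W)) : ℕ) : ℝ) := Nat.cast_nonneg _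
      calc ((t * (N / (t * W)) : ℕ) : ℝ) ≤ ((t * (N / (t * W)) : ℕ) : ℝ) * (4 * θ * W) :=
            le_mul_of_one_le_right hx hWge
        _ = 4 * θ * (((t * (N / (t * W)) : ℕ) : ℝ) * W) := by ring
        _ ≤ 4 * θ * N := by gcongr
    rw [mul_add, mul_one, Nat.cast_add]
    linarith
  have hAr : (A.card : ℝ) ≤ (R + 1) * (4 * θ * N + 2 * D) := by
    have : (A.card : ℝ) ≤ ((R + 1 : ℕ) : ℝ) * ((t * (N / (t * W) + 1) : ℕ) : ℝ) := by
      exact_mod_cast hcount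
    refine this.trans ?_
    push_cast at hblocks ⊢
    gcongr
  have hcr : (N : ℝ) ≤ D * A.card := by exact_mod_cast hcard
  have hpos2 : 0 ≤ 4 * θ * N + 2 * D := by positivity
  -- Since θ ≤ 2ε, (R + 1)θ ≤ 4ε; afterwards `hεD` lets the θN term on the right be absorbed.
  have key : θ * N ≤ D * (4 * ε) * (4 * θ * N + 2 * D) := by
    calc θ * N ≤ θ * (D * ((R + 1) * (4 * θ * N + 2 * D))) := by
          gcongr; exact hcr.trans (by gcongr)
      _ = D * (R * θ + θ) * (4 * θ * N + 2 * D) := by ring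
      _ ≤ D * (4 * ε) * (4 * θ * N + 2 * D) := by gcongr; linarith
  have h6 : 16 * ε * D * (θ * N) ≤ 1 / 2 * (θ * N) := by
    gcongr; linarith
  nlinarith

/-- Weyl's inequality in inverse form. -/
lemma weyl_inverse (k : ℕ) : ∃ C : ℕ, ∀ (M N : ℕ) (β : UnitAddCircle) (g : ℕ → UnitAddCircle),
    2 ≤ M → 1 ≤ N → HasConstDiff (k + 1) β g →
    (N : ℝ) ≤ M * ‖∑ n ∈ Finset.range N, stdChar (g n)‖ →
    ∃ t : ℕ, 1 ≤ t ∧ t ≤ M ^ C ∧ ‖t • β‖ * (N : ℝ) ^ (k + 1) ≤ (M : ℝ) ^ C := by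
  induction k with
  | zero =>
    refine ⟨1, fun M N β g hM hN hg hS => ⟨1, le_rfl, by simp; omega, ?_⟩⟩
    have hgn : ∀ n, g n = g 0 + n • β := by
      intro n
      have h := hg n 0
      simp only [zero_add] at h
      rw [← h]; abel
    have h1 : ∑ n ∈ Finset.range N, stdChar (g n) =
        stdChar (g 0) * ∑ n ∈ Finset.range N, stdChar (n • β) := by
      rw [Finset.mul_sum]
      refine Finset.sum_congr rfl fun n _ => ?_
      rw [hgn n, stdChar_add]
    rw [h1, norm_mul, norm_stdChar, one_mul] at hS
    have h2 := norm_geom_sum_stdChar β N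
    have hMr : (0 : ℝ) ≤ M := Nat.cast_nonneg _
    simp only [one_smul, zero_add, pow_one]
    calc ‖β‖ * N ≤ ‖β‖ * (M * ‖∑ n ∈ Finset.range N, stdChar (n • β)‖) := by gcongr
      _ = M * (2 * ‖β‖ * ‖∑ n ∈ Finset.range N, stdChar (n • β)‖) / 2 := by ring
      _ ≤ M * 1 / 2 := by gcongr
      _ ≤ M := by linarith
  | succ k ih =>
    obtain ⟨C, hC⟩ := ih
    -- M^a will bound the inductive estimate after 4M² is replaced by M^4; M^(-b) will be the
    -- density of shifts h sharing one multiplier t.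
    obtain ⟨a, ha⟩ : ∃ a, a = 4 * (C + k + 1) := ⟨_, rfl⟩
    obtain ⟨b, hb⟩ : ∃ b, b = 4 + 4 * C := ⟨_, rfl⟩
    refine ⟨(5 + a + b) * (k + 2), fun M N β g hM hN hg hS => ?_⟩
    have hM1 : 1 ≤ M := by omega
    have hMr : (2 : ℝ) ≤ M := by exact_mod_cast hM
    have hNr : (1 : ℝ) ≤ N := by exact_mod_cast hN
    have hfour : 4 * M ^ 2 ≤ M ^ 4 := by
      have h1 : 2 ^ 2 ≤ M ^ 2 := Nat.pow_le_pow_left hM 2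
      calc 4 * M ^ 2 ≤ M ^ 2 * M ^ 2 := Nat.mul_le_mul_right _ h1
        _ = M ^ 4 := by ring
    have hfourr : (4 * M ^ 2 : ℝ) ≤ (M : ℝ) ^ 4 := by exact_mod_cast hfour
    have hX : 32 * M ^ a * M ^ b ≤ M ^ (5 + a + b) := by
      have h1 : 2 ^ 5 ≤ M ^ 5 := Nat.pow_le_pow_left hM 5
      rw [pow_add, pow_add]
      gcongr
      simpa using h1
    have hXr : 32 * (M : ℝ) ^ a * (M : ℝ) ^ b ≤ (M : ℝ) ^ (5 + a + b) := by exact_mod_cast hX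
    -- For N at most a power of M, t = 1 is good enough. Otherwise N is large enough to apply
    -- `exists_small_multiple`.
    by_cases hNX : N ≤ M ^ (5 + a + b)
    · refine ⟨1, le_rfl, Nat.one_le_pow _ _ hM1, ?_⟩
      have h1 := UnitAddCircle.norm_le_half β
      have h2 : (N : ℝ) ≤ (M : ℝ) ^ (5 + a + b) := by exact_mod_cast hNX
      rw [one_smul, pow_mul]
      calc ‖β‖ * (N : ℝ) ^ (k + 1 + 1) ≤ 1 * ((M : ℝ) ^ (5 + a + b)) ^ (k + 2) := by
            gcongr; linarith
        _ = _ := one_mul _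
    push Not at hNX
    set S : ℕ → ℂ := fun h => ∑ n ∈ Finset.range (N - h), stdChar (g (n + h) - g n) with hSdef
    set A := (Finset.range N).filter fun h => (N : ℝ) ≤ 4 * M ^ 2 * ‖S h‖ with hA
    have hSle : ∀ h, ‖S h‖ ≤ ((N - h : ℕ) : ℝ) := fun h => by
      simpa using norm_sum_stdChar_le (Finset.range (N - h)) (fun n => g (n + h) - g n)
    -- Shifts outside `A` contribute at most half of the lower bound for the squared sum, so `A` is
    -- dense.
    have hAcard : (N : ℝ) ≤ 4 * M ^ 2 * A.card := by
      have h1 := norm_sq_sum_stdChar_le g N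
      have h2 : ∑ h ∈ Finset.range N, ‖S h‖ ≤ A.card * N + N * (N / (4 * M ^ 2)) := by
        calc ∑ h ∈ Finset.range N, ‖S h‖
            ≤ ∑ h ∈ Finset.range N, ((if h ∈ A then (N : ℝ) else 0) + N / (4 * M ^ 2)) := by
              refine Finset.sum_le_sum fun h hh => ?_
              split_ifs with hmem
              · have h3 : ((N - h : ℕ) : ℝ) ≤ N := by exact_mod_cast Nat.sub_le _ _
                have h4 : (0 : ℝ) ≤ N / (4 * M ^ 2) := by positivity
                linarith [hSle h]
              · have h3 : ¬ (N : ℝ) ≤ 4 * M ^ 2 * ‖S h‖ := fun h3 =>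
                  hmem (Finset.mem_filter.2 ⟨hh, h3⟩)
                push Not at h3
                rw [zero_add, le_div_iff₀ (by positivity)]
                linarith
          _ = A.card * N + N * (N / (4 * M ^ 2)) := by
              rw [Finset.sum_add_distrib, Finset.sum_ite_mem, Finset.inter_eq_right.2
                (Finset.filter_subset _ _), Finset.sum_const, Finset.sum_const, Finset.card_range,
                nsmul_eq_mul, nsmul_eq_mul]
      have h3 : (N : ℝ) ^ 2 ≤ M ^ 2 * (2 * (A.card * N + N * (N / (4 * M ^ 2)))) := by
        calc (N : ℝ) ^ 2 ≤ (M * ‖∑ n ∈ Finset.range N, stdChar (g n)‖) ^ 2 := by gcongr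
          _ = M ^ 2 * ‖∑ n ∈ Finset.range N, stdChar (g n)‖ ^ 2 := by ring
          _ ≤ _ := by gcongr; exact h1.trans (by gcongr)
      have h4 : (M : ℝ) ^ 2 * (2 * (A.card * N + N * (N / (4 * M ^ 2)))) =
          N * (2 * M ^ 2 * A.card + N / 2) := by
        field_simp
        ring
      rw [h4, sq] at h3
      have h5 := le_of_mul_le_mul_left h3 (by linarith)
      linarith
    have hstep : ∀ h ∈ A, ∃ t : ℕ, 1 ≤ t ∧ t ≤ M ^ (4 * C) ∧
        ‖t • h • β‖ * (N : ℝ) ^ (k + 1) ≤ (M : ℝ) ^ a := by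
      intro h hh
      obtain ⟨hhN, hSh⟩ := Finset.mem_filter.1 hh
      have hhN := Finset.mem_range.1 hhN
      obtain ⟨t, ht1, ht2, ht3⟩ := hC (4 * M ^ 2) (N - h) (h • β) (fun n => g (n + h) - g n)
        (by nlinarith) (by omega) (hg h) (by
          have h3 : ((N - h : ℕ) : ℝ) ≤ N := by exact_mod_cast Nat.sub_le _ _
          push_cast
          exact h3.trans hSh)
      refine ⟨t, ht1, ht2.trans ?_, ?_⟩
      · rw [pow_mul]; exact Nat.pow_le_pow_left hfour _
      · push_cast at ht3
        -- A large `S h` forces N - h ≥ N/(4M²), so the shorter range costs only powers of M.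
        have h4 : (N : ℝ) ≤ 4 * M ^ 2 * ((N - h : ℕ) : ℝ) := hSh.trans (by gcongr; exact hSle h)
        calc ‖t • h • β‖ * (N : ℝ) ^ (k + 1)
            ≤ ‖t • h • β‖ * (4 * M ^ 2 * ((N - h : ℕ) : ℝ)) ^ (k + 1) := by gcongr
          _ = (4 * M ^ 2) ^ (k + 1) * (‖t • h • β‖ * ((N - h : ℕ) : ℝ) ^ (k + 1)) := by
              rw [mul_pow]; ring
          _ ≤ (4 * M ^ 2) ^ (k + 1) * (4 * M ^ 2) ^ C := by gcongr
          _ = (4 * M ^ 2) ^ (C + k + 1) := by rw [← pow_add]; congr 1; ring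
          _ ≤ ((M : ℝ) ^ 4) ^ (C + k + 1) := by gcongr
          _ = (M : ℝ) ^ a := by rw [← pow_mul, ha]
    choose! τ hτ1 hτ2 hτ3 using hstep
    have hAcard' : N ≤ 4 * M ^ 2 * A.card := by exact_mod_cast hAcard
    have hAne : (Finset.Icc 1 (M ^ (4 * C))).Nonempty :=
      ⟨1, by simp [Nat.one_le_pow _ _ hM1]⟩
    -- Pigeonhole: the multiplier depends on h but takes at most M^(4C) values.
    obtain ⟨t, ht, htcard⟩ : ∃ t ∈ Finset.Icc 1 (M ^ (4 * C)),
        A.card ≤ M ^ (4 * C) * (A.filter fun h => τ h = t).card := by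
      by_contra! hlt
      have h1 := Finset.card_eq_sum_card_fiberwise (s := A) (f := τ)
        (t := Finset.Icc 1 (M ^ (4 * C))) (fun h hh => by
          have hh' : h ∈ A := hh
          simp [hτ1 h hh', hτ2 h hh'])
      have h2 := Finset.sum_lt_sum_of_nonempty hAne hlt
      rw [← Finset.mul_sum, ← h1, Finset.sum_const, Nat.card_Icc, smul_eq_mul] at h2
      simp at h2
    obtain ⟨ht1, ht2⟩ := Finset.mem_Icc.1 ht
    have hNpow : (0 : ℝ) < (N : ℝ) ^ (k + 1) := by positivity
    have hNXr : (M : ℝ) ^ (5 + a + b) ≤ N := by exact_mod_cast hNX.le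
    have hMa : 1 ≤ M ^ a := Nat.one_le_pow _ _ hM1
    have hMb : 1 ≤ M ^ b := Nat.one_le_pow _ _ hM1
    obtain ⟨s, hs1, hs2, hs3⟩ := exists_small_multiple (N := N) (D := M ^ b)
      (A := A.filter fun h => τ h = t) (ε := (M : ℝ) ^ a / (N : ℝ) ^ (k + 1)) (β := t • β)
      ((Finset.filter_subset _ _).trans (Finset.filter_subset _ _)) (by nlinarith)
      (by
        calc N ≤ 4 * M ^ 2 * A.card := hAcard'
          _ ≤ M ^ 4 * (M ^ (4 * C) * (A.filter fun h => τ h = t).card) := by gcongr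
          _ = _ := by rw [hb, pow_add]; ring)
      (by
        have h1 : (N : ℝ) ≤ (N : ℝ) ^ (k + 1) := le_self_pow₀ hNr (by omega)
        rw [mul_div_assoc', div_mul_eq_mul_div, div_le_one hNpow]
        push_cast
        linarith)
      (fun h hh => by
        obtain ⟨hhA, rfl⟩ := Finset.mem_filter.1 hh
        rw [le_div_iff₀ hNpow, smul_comm]
        exact hτ3 h hhA)
    have hpow2 : (M ^ (5 + a + b)) ^ 2 ≤ M ^ ((5 + a + b) * (k + 2)) := by
      rw [← pow_mul]
      exact Nat.pow_le_pow_right hM1 (Nat.mul_le_mul_left _ (by omega))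
    refine ⟨s * t, Nat.mul_pos hs1 ht1, ?_, ?_⟩
    · refine le_trans ?_ hpow2
      have h1 : M ^ (4 * C) ≤ M ^ (5 + a + b) := Nat.pow_le_pow_right hM1 (by omega)
      rw [sq]
      refine Nat.mul_le_mul (hs2.trans ?_) (ht2.trans h1)
      nlinarith
    · have hpow2r : ((M : ℝ) ^ (5 + a + b)) ^ 2 ≤ (M : ℝ) ^ ((5 + a + b) * (k + 2)) := by
        exact_mod_cast hpow2
      refine le_trans ?_ hpow2r
      have hMar : (1 : ℝ) ≤ (M : ℝ) ^ a := by exact_mod_cast hMa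
      have hMbr : (1 : ℝ) ≤ (M : ℝ) ^ b := by exact_mod_cast hMb
      push_cast at hs3
      rw [mul_nsmul']
      calc ‖s • t • β‖ * (N : ℝ) ^ (k + 1 + 1) = ‖s • t • β‖ * N * (N : ℝ) ^ (k + 1) := by ring
        _ ≤ 16 * ((M : ℝ) ^ a / (N : ℝ) ^ (k + 1)) * ((M : ℝ) ^ b) ^ 2 * (N : ℝ) ^ (k + 1) := by
            gcongr
        _ = 16 * (M : ℝ) ^ a * 1 * ((M : ℝ) ^ b) ^ 2 := by field_simp
        _ ≤ (32 * (M : ℝ) ^ a) * (M : ℝ) ^ a * ((M : ℝ) ^ b) ^ 2 := by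
            gcongr ?_ * ?_ * _
            · linarith
        _ ≤ (32 * (M : ℝ) ^ a * (M : ℝ) ^ b) ^ 2 := by
            have : (0 : ℝ) ≤ ((M : ℝ) ^ a) ^ 2 * ((M : ℝ) ^ b) ^ 2 := by positivity
            nlinarith
        _ ≤ _ := by gcongr

/-! ### Heilbronn's theorem, for one and for several frequencies -/

/-- If no point of a finite sequence is close to `0`, then some low-frequency exponential sum along
the sequence is large. -/
lemma exists_large_sum_stdChar {M Q : ℕ} (hM : 1 ≤ M) (hQ : 1 ≤ Q) (x : ℕ → UnitAddCircle)
    (hx : ∀ n < Q, 1 < ‖x n‖ * M) :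
    ∃ h : ℕ, 1 ≤ h ∧ h ≤ M ^ 2 ∧
      (Q : ℝ) ≤ 2 * M ^ 2 * ‖∑ n ∈ Finset.range Q, stdChar (h • x n)‖ := by
  by_contra! hcon
  have hMr : (1 : ℝ) ≤ M := by exact_mod_cast hM
  have hQr : (1 : ℝ) ≤ Q := by exact_mod_cast hQ
  -- The second moment of a length-M² Dirichlet kernel over the x n is at most QM²/4, as each x n is
  -- far from 0; small exponential sums would make it at least QM²/2.
  have hupper : ∑ n ∈ Finset.range Q, ‖∑ j ∈ Finset.range (M ^ 2), stdChar (j • x n)‖ ^ 2 ≤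
      Q * (M ^ 2 / 4) := by
    calc _ ≤ ∑ n ∈ Finset.range Q, ((M : ℝ) ^ 2 / 4) := by
          refine Finset.sum_le_sum fun n hn => ?_
          have h1 := norm_geom_sum_stdChar (x n) (M ^ 2)
          have h2 := hx n (Finset.mem_range.1 hn)
          set D := ‖∑ j ∈ Finset.range (M ^ 2), stdChar (j • x n)‖
          have hD : 0 ≤ D := norm_nonneg _
          have h3 : D ≤ M / 2 := by
            calc D ≤ ‖x n‖ * M * D := le_mul_of_one_le_left hD h2.le
              _ = 2 * ‖x n‖ * D * (M / 2) := by ring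
              _ ≤ 1 * (M / 2) := by gcongr
              _ = _ := one_mul _
          calc D ^ 2 ≤ (M / 2 : ℝ) ^ 2 := by gcongr
            _ = _ := by ring
      _ = _ := by simp
  have hoff : ∀ i < M ^ 2, ∀ j < i,
      -(Q / (2 * M ^ 2) : ℝ) ≤ ∑ n ∈ Finset.range Q, (stdChar (i • x n - j • x n)).re := by
    intro i hi j hj
    have h1 := hcon (i - j) (by omega) (by omega)
    have h2 : ∑ n ∈ Finset.range Q, (stdChar (i • x n - j • x n)).re =
        (∑ n ∈ Finset.range Q, stdChar ((i - j) • x n)).re := by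
      rw [Complex.re_sum]
      refine Finset.sum_congr rfl fun n _ => ?_
      rw [sub_nsmul _ hj.le, ← sub_eq_add_neg]
    rw [h2]
    have h3 := (abs_le.1 (Complex.abs_re_le_norm
      (∑ n ∈ Finset.range Q, stdChar ((i - j) • x n)))).1
    have h4 : ‖∑ n ∈ Finset.range Q, stdChar ((i - j) • x n)‖ ≤ Q / (2 * M ^ 2) := by
      rw [le_div_iff₀ (by positivity)]; linarith
    linarith
  -- The off-diagonal loss is charged to the diagonal as well, for a uniform summand.
  have hlower : ∑ i ∈ Finset.range (M ^ 2), ∑ j ∈ Finset.range (M ^ 2),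
      ((if i = j then (Q : ℝ) else 0) - Q / (2 * M ^ 2)) ≤
      ∑ n ∈ Finset.range Q, ‖∑ j ∈ Finset.range (M ^ 2), stdChar (j • x n)‖ ^ 2 := by
    simp_rw [norm_sq_sum_stdChar_eq]
    rw [Finset.sum_comm (s := Finset.range Q)]
    refine Finset.sum_le_sum fun i hi => ?_
    rw [Finset.sum_comm (s := Finset.range Q)]
    refine Finset.sum_le_sum fun j hj => ?_
    rw [Finset.mem_range] at hi hj
    rcases lt_trichotomy i j with hij | rfl | hij
    · rw [if_neg hij.ne, zero_sub]
      simp_rw [re_stdChar_sub_comm (i • _)]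
      exact hoff j hj i hij
    · have : (0 : ℝ) ≤ Q / (2 * M ^ 2) := by positivity
      simpa [stdChar_zero] using this
    · rw [if_neg hij.ne', zero_sub]
      exact hoff i hi j hij
  have heval : ∑ i ∈ Finset.range (M ^ 2), ∑ j ∈ Finset.range (M ^ 2),
      ((if i = j then (Q : ℝ) else 0) - Q / (2 * M ^ 2)) = (Q : ℝ) * (M ^ 2 / 2) := by
    have h1 : ∀ i ∈ Finset.range (M ^ 2), ∑ j ∈ Finset.range (M ^ 2),
        ((if i = j then (Q : ℝ) else 0) - Q / (2 * M ^ 2)) = (Q : ℝ) / 2 := by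
      intro i hi
      rw [Finset.sum_sub_distrib, Finset.sum_ite_eq, if_pos hi, Finset.sum_const,
        Finset.card_range, nsmul_eq_mul]
      push_cast
      field_simp
      ring
    rw [Finset.sum_congr rfl h1, Finset.sum_const, Finset.card_range, nsmul_eq_mul]
    push_cast
    ring
  rw [heval] at hlower
  have : (0 : ℝ) < Q * M ^ 2 := by positivity
  linarith

/-- Heilbronn's theorem for `k`-th powers, with an unspecified exponent. -/
lemma exists_pow_nsmul_small (k : ℕ) (hk : 1 ≤ k) : ∃ C : ℕ, ∀ (M : ℕ) (α : UnitAddCircle),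
    1 ≤ M → ∃ q : ℕ, 1 ≤ q ∧ q ≤ M ^ C ∧ ‖(q ^ k) • α‖ * M ≤ 1 := by
  obtain ⟨l, rfl⟩ : ∃ l, k = l + 1 := ⟨k - 1, by omega⟩
  obtain ⟨C, hC⟩ := weyl_inverse l
  obtain ⟨r, hr⟩ : ∃ r, r = 3 * C + (l + 1).factorial + 2 := ⟨_, rfl⟩
  refine ⟨r * (l + 1) + 3 * C + 1, fun M α hM => ?_⟩
  rcases hM.eq_or_lt with rfl | hM2
  · refine ⟨1, le_rfl, by simp, ?_⟩
    have := UnitAddCircle.norm_le_half α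
    simp
    linarith
  by_contra! hcon
  set Q := M ^ (r * (l + 1) + 3 * C + 1) with hQ
  have hMr : (1 : ℝ) ≤ M := by exact_mod_cast hM
  have hQ1 : 1 ≤ Q := Nat.one_le_pow _ _ hM
  have hQr : (1 : ℝ) ≤ Q := by exact_mod_cast hQ1
  obtain ⟨h, hh1, hh2, hS⟩ := exists_large_sum_stdChar hM hQ1
    (fun n => ((n + 1) ^ (l + 1)) • α) (fun n hn => hcon (n + 1) (by omega) (by omega))
  have hdeg : HasConstDiff (l + 1) ((l + 1).factorial • h • α)
      (fun n => h • ((n + 1) ^ (l + 1)) • α) := by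
    simp_rw [smul_comm h]
    exact (hasConstDiff_pow (l + 1) (h • α)).shift 1
  have hcube : 2 * M ^ 2 ≤ M ^ 3 := by
    rw [pow_succ' M 2]
    gcongr
    exact hM2
  obtain ⟨t, ht1, ht2, ht3⟩ := hC (M ^ 3) Q _ _ (by nlinarith) hQ1 hdeg (by
    refine hS.trans ?_
    gcongr
    exact_mod_cast hcube)
  have hfac : (l + 1).factorial ≤ M ^ (l + 1).factorial :=
    ((Nat.lt_pow_self hM2).le)
  have hqr : t * (l + 1).factorial * h ≤ M ^ r := by
    calc t * (l + 1).factorial * h ≤ (M ^ 3) ^ C * M ^ (l + 1).factorial * M ^ 2 := by gcongr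
      _ = M ^ r := by rw [← pow_mul, ← pow_add, ← pow_add, hr]
  have hq1 : 1 ≤ t * (l + 1).factorial * h :=
    Nat.mul_pos (Nat.mul_pos ht1 (Nat.factorial_pos _)) hh1
  -- The multiplier from `weyl_inverse` itself serves as q: it is at most M^r, so passing from qα to
  -- q^(l+1) α loses only M^(r l).
  set q := t * (l + 1).factorial * h with hq
  have hqα : q • α = t • (l + 1).factorial • h • α := by
    rw [hq, mul_nsmul', mul_nsmul']
  have hfin := hcon q hq1 (hqr.trans (Nat.pow_le_pow_right hM (by nlinarith)))
  refine absurd hfin (not_lt.2 ?_)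
  rw [← hqα] at ht3
  have h5 : ‖q • α‖ * Q ≤ (M : ℝ) ^ (3 * C) := by
    calc ‖q • α‖ * Q ≤ ‖q • α‖ * (Q : ℝ) ^ (l + 1) := by
          gcongr; exact le_self_pow₀ hQr (by omega)
      _ ≤ _ := ht3
      _ = _ := by push_cast; rw [← pow_mul]
  have h6 : ‖(q ^ (l + 1)) • α‖ ≤ (M : ℝ) ^ (r * l) * ‖q • α‖ := by
    have hqr' : (q : ℝ) ^ l ≤ (M : ℝ) ^ (r * l) := by
      rw [pow_mul]; exact_mod_cast Nat.pow_le_pow_left hqr l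
    rw [pow_succ, mul_nsmul']
    refine (UnitAddCircle.norm_nsmul_le _ _).trans ?_
    push_cast
    gcongr
  have h7 : ‖(q ^ (l + 1)) • α‖ * M * Q ≤ 1 * Q := by
    calc ‖(q ^ (l + 1)) • α‖ * M * Q ≤ (M : ℝ) ^ (r * l) * ‖q • α‖ * M * Q := by gcongr
      _ = (M : ℝ) ^ (r * l) * (‖q • α‖ * Q) * M := by ring
      _ ≤ (M : ℝ) ^ (r * l) * (M : ℝ) ^ (3 * C) * M := by gcongr
      _ = (M : ℝ) ^ (r * l + 3 * C + 1) := by rw [pow_succ, pow_add]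
      _ ≤ (M : ℝ) ^ (r * (l + 1) + 3 * C + 1) := by
          exact pow_le_pow_right₀ hMr (by nlinarith)
      _ = 1 * Q := by rw [hQ, one_mul]; push_cast; rfl
  exact le_of_mul_le_mul_right h7 (by linarith)

/-- Induction on K: multiplying q by s, to treat a new α, worsens the old bounds by s^k ≤ M^(C k),
so the old frequencies are first handled with M^(C k + 1) in place of M. -/
lemma exists_pow_nsmul_small_simultaneous (k : ℕ) (hk : 1 ≤ k) :
    ∃ B : ℕ, 1 ≤ B ∧ ∀ (K : Finset UnitAddCircle) (M : ℕ), 1 ≤ M →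
      ∃ q : ℕ, 1 ≤ q ∧ q ≤ M ^ (B ^ K.card) ∧ ∀ α ∈ K, ‖(q ^ k) • α‖ * M ≤ 1 := by
  obtain ⟨C, hC⟩ := exists_pow_nsmul_small k hk
  refine ⟨C * (k + 1) + 1, by omega, fun K => ?_⟩
  set B := C * (k + 1) + 1
  induction K using Finset.induction_on with
  | empty => exact fun M hM => ⟨1, le_rfl, Nat.one_le_pow _ _ hM, by simp⟩
  | insert α K hα ih =>
    intro M hM
    obtain ⟨q, hq1, hq2, hq3⟩ := ih (M ^ (C * k + 1)) (Nat.one_le_pow _ _ hM)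
    obtain ⟨s, hs1, hs2, hs3⟩ := hC M ((q ^ k) • α) hM
    refine ⟨s * q, Nat.mul_pos hs1 hq1, ?_, ?_⟩
    · rw [Finset.card_insert_of_notMem hα]
      calc s * q ≤ M ^ C * (M ^ (C * k + 1)) ^ B ^ K.card := Nat.mul_le_mul hs2 hq2
        _ = M ^ (C + (C * k + 1) * B ^ K.card) := by rw [← pow_mul, ← pow_add]
        _ ≤ M ^ (B ^ (K.card + 1)) := by
          refine Nat.pow_le_pow_right hM ?_
          have h1 : 1 ≤ B ^ K.card := Nat.one_le_pow _ _ (by omega)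
          calc C + (C * k + 1) * B ^ K.card ≤ C * B ^ K.card + (C * k + 1) * B ^ K.card := by
                gcongr; exact Nat.le_mul_of_pos_right _ h1
            _ = B ^ (K.card + 1) := by rw [pow_succ]; ring
    · intro β hβ
      have hsplit : ((s * q) ^ k) • β = (s ^ k) • (q ^ k) • β := by
        rw [mul_pow, mul_nsmul']
      rw [hsplit]
      rcases Finset.mem_insert.1 hβ with rfl | hβ
      · exact hs3
      · have h1 := hq3 β hβ
        push_cast at h1
        have h2 : (s : ℝ) ^ k ≤ (M : ℝ) ^ (C * k) := by
          rw [pow_mul]; exact_mod_cast Nat.pow_le_pow_left hs2 k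
        calc ‖(s ^ k) • (q ^ k) • β‖ * M ≤ ((s ^ k : ℕ) * ‖(q ^ k) • β‖) * M := by
              gcongr; exact UnitAddCircle.norm_nsmul_le _ _
          _ ≤ ((M : ℝ) ^ (C * k) * ‖(q ^ k) • β‖) * M := by push_cast; gcongr
          _ = ‖(q ^ k) • β‖ * (M : ℝ) ^ (C * k + 1) := by rw [pow_succ]; ring
          _ ≤ 1 := h1

/-! ### The progression inside the Bohr set -/

/-- The progression `0, Q, …, (L - 1) Q` lies in the Bohr set once `Q` nearly annihilates `K`. -/
lemma progression_subset_bohrSet {N Q L : ℕ} {K : Finset UnitAddCircle} {η : ℝ}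
    (hN : ∀ i < L, 2 * (i * Q) < N) (hK : ∀ i < L, ∀ α ∈ K, i * ‖Q • α‖ ≤ η) :
    (((Finset.range L).image (fun i : ℕ => (0 : ℤ) + (i : ℤ) * (Q : ℤ)) : Finset ℤ) : Set ℤ) ⊆
      bohrSet N K η := by
  intro x hx
  obtain ⟨i, hi, rfl⟩ := Finset.mem_image.1 (Finset.mem_coe.1 hx)
  rw [Finset.mem_range] at hi
  have h1 : (2 * ((i : ℝ) * Q)) < N := by exact_mod_cast hN i hi
  have h2 : (0 : ℝ) ≤ (i : ℝ) * Q := by positivity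
  refine ⟨?_, ?_, fun α hα => ?_⟩
  · push_cast; linarith
  · push_cast; linarith
  · have h3 : ((0 : ℤ) + (i : ℤ) * (Q : ℤ)) • α = i • Q • α := by
      rw [zero_add, ← Nat.cast_mul, natCast_zsmul, mul_nsmul']
    rw [h3]
    exact (UnitAddCircle.norm_nsmul_le _ _).trans (hK i hi α hα)

lemma card_progression {Q : ℕ} (hQ : 1 ≤ Q) (L : ℕ) :
    ((Finset.range L).image (fun i : ℕ => (0 : ℤ) + (i : ℤ) * (Q : ℤ))).card = L := by
  rw [Finset.card_image_of_injective, Finset.card_range]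
  intro i j hij
  have hQ' : Q ≠ 0 := by omega
  simpa [hQ'] using hij

theorem lemma6p2 (k : ℕ) (hk : 1 ≤ k) :
    ∃ C c : ℝ, 0 < C ∧ 0 < c ∧
      ∀ (N : ℕ) (K : Finset UnitAddCircle) (η : ℝ), 1 ≤ N → 0 < η → η ≤ 1 →
        ∃ P : Finset ℤ, IsKthPowerProgression k P ∧ (P : Set ℤ) ⊆ bohrSet N K η ∧
          c * η * (N : ℝ) ^ Real.exp (-C * (K.card : ℝ)) ≤ (P.card : ℝ) := by
  obtain ⟨B, hB, hBK⟩ := exists_pow_nsmul_small_simultaneous k hk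
  have hkB : 1 ≤ k * B := Nat.mul_pos hk hB
  have hkBr : (1 : ℝ) ≤ ((k * B : ℕ) : ℝ) := by exact_mod_cast hkB
  refine ⟨Real.log ((k * B : ℕ) + 1), 1 / 4, Real.log_pos (by linarith), by norm_num,
    fun N K η hN hη hη1 => ?_⟩
  have hNr : (1 : ℝ) ≤ N := by exact_mod_cast hN
  -- it suffices to find `q` and `L`
  suffices h : ∃ q L : ℕ, 1 ≤ q ∧ (∀ i < L, 2 * (i * q ^ k) < N) ∧
      (∀ i < L, ∀ α ∈ K, i * ‖(q ^ k) • α‖ ≤ η) ∧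
      1 / 4 * η * (N : ℝ) ^ Real.exp (-Real.log ((k * B : ℕ) + 1) * (K.card : ℝ)) ≤ L by
    obtain ⟨q, L, hq, h1, h2, h3⟩ := h
    refine ⟨_, ⟨0, q, L, hq, rfl⟩, ?_, ?_⟩
    · have := progression_subset_bohrSet h1 h2
      push_cast at this ⊢
      exact this
    · have := card_progression (Nat.one_le_pow k q hq) L
      push_cast at this
      rw [this]
      exact h3
  have hexp : Real.exp (-Real.log ((k * B : ℕ) + 1) * (K.card : ℝ)) =
      ((((k * B : ℕ) : ℝ) + 1) ^ K.card)⁻¹ := by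
    rw [neg_mul, Real.exp_neg, mul_comm, Real.exp_nat_mul, Real.exp_log (by linarith)]
  rw [hexp]
  rcases K.eq_empty_or_nonempty with rfl | hKne
  -- With no frequencies the exponent of N is 1, and only the interval restricts the progression.
  · refine ⟨1, (N + 1) / 2, le_rfl, fun i hi => by rw [one_pow]; omega, by simp, ?_⟩
    have h1 : N ≤ 2 * ((N + 1) / 2) := by omega
    have h2 : (N : ℝ) ≤ 2 * (((N + 1) / 2 : ℕ) : ℝ) := by exact_mod_cast h1
    simp only [Finset.card_empty, pow_zero, inv_one, Real.rpow_one]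
    nlinarith
  set d := K.card
  have hd : 1 ≤ d := hKne.card_pos
  set x := (N : ℝ) ^ (((((k * B : ℕ) : ℝ) + 1) ^ d)⁻¹) with hx
  have hx1 : 1 ≤ x := Real.one_le_rpow hNr (by positivity)
  rcases lt_or_ge x 2 with hx2 | hx2
  -- Here ηx/4 < 1, so the single point 0 suffices.
  · refine ⟨1, 1, le_rfl, fun i hi => ?_, fun i hi α hα => ?_, ?_⟩
    · obtain rfl : i = 0 := by omega
      omega
    · obtain rfl : i = 0 := by omega
      simpa using hη.le
    · push_cast
      nlinarith
  -- Halving x gives 2M^e ≤ 2N/2^e < N, because e ≥ 2.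
  set M := ⌊x / 2⌋₊ with hM
  have hMle : (M : ℝ) ≤ x / 2 := Nat.floor_le (by linarith)
  have hM1 : 1 ≤ M := Nat.le_floor (by push_cast; linarith)
  have hMge : x / 4 ≤ M := by
    have h1 : x / 2 < M + 1 := Nat.lt_floor_add_one _
    have h2 : (1 : ℝ) ≤ M := by exact_mod_cast hM1
    linarith
  obtain ⟨q, hq1, hq2, hq3⟩ := hBK K M hM1
  have hMr : (0 : ℝ) < M := by exact_mod_cast hM1
  have hiM : ∀ i < ⌊η * M⌋₊ + 1, (i : ℝ) ≤ η * M := fun i hi =>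
    (Nat.cast_le.2 (Nat.lt_succ_iff.1 hi)).trans (Nat.floor_le (by positivity))
  -- The extra term is i = 0; it makes the length exceed ηM.
  refine ⟨q, ⌊η * M⌋₊ + 1, hq1, fun i hi => ?_, fun i hi α hα => ?_, ?_⟩
  · have hi1 : i ≤ M := by
      have : (i : ℝ) ≤ M := (hiM i hi).trans (mul_le_of_le_one_left hMr.le hη1)
      exact_mod_cast this
    set e := (k * B + 1) ^ d with he
    have hexpo : 1 + B ^ d * k ≤ e := by
      have h1 : (k * B) ^ d + 1 ≤ (k * B + 1) ^ d := by
        simpa using pow_add_pow_le (Nat.zero_le (k * B)) zero_le_one (by omega : d ≠ 0)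
      have h2 : B ^ d * k ≤ (k * B) ^ d := by
        rw [mul_pow, mul_comm]
        exact Nat.mul_le_mul_right _ (Nat.le_self_pow (by omega) k)
      omega
    have h3 : 2 * (i * q ^ k) ≤ 2 * M ^ e := by
      have : i * q ^ k ≤ M ^ e := by
        calc i * q ^ k ≤ M * (M ^ B ^ d) ^ k := by gcongr
          _ = M ^ (1 + B ^ d * k) := by rw [← pow_mul, pow_add, pow_one]
          _ ≤ M ^ e := Nat.pow_le_pow_right hM1 hexpo
      omega
    have he2 : 2 ≤ e := by
      have : 1 ≤ B ^ d * k := Nat.mul_pos (Nat.pow_pos hB) hk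
      omega
    have hxe : x ^ e = N := by
      have : ((((k * B : ℕ) : ℝ) + 1) ^ d) = (e : ℝ) := by rw [he]; push_cast; rfl
      rw [hx, this, Real.rpow_inv_natCast_pow (by positivity) (by omega)]
    have h4 : 2 * (M : ℝ) ^ e < N := by
      calc 2 * (M : ℝ) ^ e ≤ 2 * (x / 2) ^ e := by gcongr
        _ = 2 * (N / 2 ^ e) := by rw [div_pow, hxe]
        _ ≤ 2 * (N / 2 ^ 2) := by gcongr; norm_num
        _ < N := by linarith
    have h5 : 2 * M ^ e < N := by exact_mod_cast h4
    omega
  · calc i * ‖(q ^ k) • α‖ ≤ η * M * ‖(q ^ k) • α‖ := by gcongr; exact hiM i hi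
      _ = η * (‖(q ^ k) • α‖ * M) := by ring
      _ ≤ η * 1 := by gcongr; exact hq3 α hα
      _ = η := mul_one _
  · have h1 : η * M < ⌊η * M⌋₊ + 1 := Nat.lt_floor_add_one _
    push_cast
    calc 1 / 4 * η * x = η * (x / 4) := by ring
      _ ≤ η * M := by gcongr
      _ ≤ _ := h1.le
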